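/- Let $(X,\mathcal A,m)$ be a probability space and $T:X\to X$ a measurable map that is non-singular with respect to $m$ ($m(A)=0\Rightarrow m(T^{-1}A)=0$). Let $P:L^1(m)\to L^1(m)$ (complex-valued functions) be its Perron–Frobenius operator, $Pf=\frac{d m_f}{dm}$ with $m_f(A)=\int_{T^{-1}A}f\,dm$. Let $\mathcal B\subset L^1(m)$ be a linear subspace with a norm $\|\cdot\|_{\mathcal B}$ such that: 1. $(\mathcal B,\|\cdot\|_{\mathcal B})$ is a complex Banach space and the inclusion $\mathcal B\to L^1(m)$ is continuous; 2. the constant functions lie in $\mathcal B$; 3. there is $C>0$ such that $fg\in\mathcal B$ and $\|fg\|_{\mathcal B}\le C\|f\|_{\mathcal B}\|g\|_{\mathcal B}$ for all $f,g\in\mathcal B$; 4. $\bar f,|f|\in\mathcal B$ for every $f\in\mathcal B$; 5. $P(\mathcal B)\subset\mathcal B$, and $P$ is a bounded operator on $\mathcal B$ with spectral radius $1$; 6. $P$ is quasi-compact of diagonal type on $\mathcal B$: $P=\sum_{i=1}^s\lambda_i\Pi_i+Q$ on $\mathcal B$, where $|\lambda_i|=1$, the $\Pi_i$ are bounded projections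 of finite rank with $\Pi_i\Pi_j=0$ for $i\ne j$, and $Q$ is a bounded operator on $\mathcal B$ with spectral radius strictly less than $1$ and $Q\Pi_i=\Pi_iQ=0$ for all $i$; 7. $1$ is a simple eigenvalue of $P$ on $\mathcal B$, and $P$ has no other eigenvalue of modulus $1$ on $\mathcal B$. Then there is a unique $T$-invariant probability measure $\mu\ll m$ with $\frac{d\mu}{dm}\in\mathcal B$. Let $\phi:X\to\mathbb R$ be a bounded function (boundedness $m$-almost everywhere suffices) lying in $\mathcal B$ with $\int\phi\,d\mu=0$, and let $S_n=\sum_{k=0}^{n-1}\phi\circ T^k$. Then the limit $$\sigma^2=\lim_{n\to\infty}\int\Big(\frac{S_n}{\sqrt n}\Big)^2d\mu\in[0,\infty)$$ exists, and for every probability measure $\nu\ll m$ with $\frac{d\nu}{dm}\in\mathcal B$, $S_n/\sqrt n$ converges in distribution to $\mathcal N(0,\sigma^2)$ on $(X,\mathcal A,\nu)$: for every bounded continuous $g:\mathbb R\to\mathbb R$, $$\lim_{n\to\infty}\int g\Big(\frac{S_n}{\sqrt n}\Big)\,d\nu=\int g\,d\mathcal N(0,\sigma^2),$$ where $\mathcal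 N(0,\sigma^2)$ is the Gaussian law with mean $0$ and variance $\sigma^2$ if $\sigma^2>0$, and the Dirac mass $\delta_0$ if $\sigma^2=0$. -/

import Mathlib

open MeasureTheory ProbabilityTheory Filter Topology
open scoped NNReal ENNReal BoundedContinuousFunction

namespace TransferCLT

/-- The Perron-Frobenius (transfer) operator of `T` with respect to `m`: `P f = d m_f / d m`, where
`m_f` is the complex measure `A ↦ ∫ x in T ⁻¹' A, f x ∂m`. -/
noncomputable def perronFrobenius {X : Type*} [MeasurableSpace X] (m : Measure X) (T : X → X)
    (f : X → ℂ) : X → ℂ :=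
  ComplexMeasure.rnDeriv ((m.withDensityᵥ f).map T) m

/-- Quasi-compactness of diagonal type for a bounded operator `P`, whose spectral radius is one:
`P = ∑ i, lam i • Proj i + Q` with `lam i` of modulus one, `Proj i` mutually orthogonal projections
of finite rank, and `Q` of spectral radius less than one, with `Q (Proj i) = (Proj i) Q = 0`. -/
def IsQuasiCompactDiagonal {B : Type*} [NormedAddCommGroup B] [NormedSpace ℂ B]
    (P : B →L[ℂ] B) : Prop :=
  ∃ (s : ℕ) (lam : Fin s → ℂ) (Proj : Fin s → (B →L[ℂ] B)) (Q : B →L[ℂ] B),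
    P = ∑ i, lam i • Proj i + Q ∧
    (∀ i, ‖lam i‖ = 1) ∧
    (∀ i, Proj i * Proj i = Proj i) ∧
    (∀ i, FiniteDimensional ℂ (LinearMap.range (Proj i : B →ₗ[ℂ] B))) ∧
    (∀ i j, i ≠ j → Proj i * Proj j = 0) ∧
    (∀ i, Q * Proj i = 0 ∧ Proj i * Q = 0) ∧
    spectralRadius ℂ Q < 1

section Space

variable {X : Type*} [MeasurableSpace X] {m : Measure X}
  {B : Type*} [NormedAddCommGroup B] [NormedSpace ℂ B]

/-- The function `f` lies (modulo `m`-null sets) in the space `B`, where `B` is viewed inside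
`L¹(m)` through `ι`. -/
def InSpace (ι : B →L[ℂ] Lp ℂ 1 m) (f : X → ℂ) : Prop :=
  ∃ b : B, ⇑(ι b) =ᵐ[m] f

/-- `ν` is a probability measure, absolutely continuous with respect to `m`, with density in `B`. -/
structure IsProbWithDensityIn (ι : B →L[ℂ] Lp ℂ 1 m) (ν : Measure X) : Prop where
  prob : IsProbabilityMeasure ν
  ac : ν ≪ m
  density : InSpace ι (fun x => ((ν.rnDeriv m x).toReal : ℂ))

/-- `μ` is a `T`-invariant probability measure, absolutely continuous with respect to `m`, with
density in `B`. -/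
structure IsAcipIn (ι : B →L[ℂ] Lp ℂ 1 m) (T : X → X) (μ : Measure X) : Prop extends
    IsProbWithDensityIn ι μ where
  invariant : MeasurePreserving T μ μ

/-- The assumptions on the subspace `B ⊆ L¹(m)` (the subspace being given, with its own norm, by the
continuous injection `ι`) and on the transfer operator, whose restriction to `B` is `P`. -/
structure IsAdmissible (ι : B →L[ℂ] Lp ℂ 1 m) (T : X → X) (P : B →L[ℂ] B) : Prop where
  /-- `B` is a subspace of `L¹(m)`. -/
  injective : Function.Injective ι
  /-- Constant functions lie in `B`. -/
  const_mem : ∀ c : ℂ, InSpace ι (fun _ => c)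
  /-- `B` is a Banach algebra for the pointwise product. -/
  mul_mem : ∃ C : ℝ, 0 < C ∧ ∀ f g : B, ∃ h : B,
    (⇑(ι h) =ᵐ[m] fun x => ι f x * ι g x) ∧ ‖h‖ ≤ C * ‖f‖ * ‖g‖
  /-- `B` is stable under complex conjugation. -/
  conj_mem : ∀ f : B, InSpace ι (fun x => (starRingEnd ℂ) (ι f x))
  /-- `B` is stable under the modulus. -/
  abs_mem : ∀ f : B, InSpace ι (fun x => ((‖ι f x‖ : ℝ) : ℂ))
  /-- `B` is stable under the transfer operator, which acts on `B` as the bounded operator `P`. -/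
  transfer : ∀ f : B, ⇑(ι (P f)) =ᵐ[m] perronFrobenius m T (ι f)
  spectralRadius_eq : spectralRadius ℂ P = 1
  quasiCompact : IsQuasiCompactDiagonal P
  /-- `1` is a simple eigenvalue. -/
  simple_one : Module.finrank ℂ (Module.End.eigenspace (P : B →ₗ[ℂ] B) 1) = 1
  /-- There is no other eigenvalue of modulus `1`. -/
  unique_one : ∀ z : ℂ, Module.End.HasEigenvalue (P : B →ₗ[ℂ] B) z → ‖z‖ = 1 → z = 1

end Space

end TransferCLT

/-! Quasi-compactness enters through one fact (`IsAdmissible.exists_isTransfer_sub`): every element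
of `B` with zero integral has the form `w - P w` with `w` in `B`. Indeed the peripheral part of `P`
is `E g = (∫ g) h`, and `1 - P` is invertible on `ker E`.

No perturbation theory of the twisted operators `f ↦ P (exp (i t φ) f)` is needed. Solving two such
equations gives `u = h + i t A + t² b` with `P (exp (i t φ) u) = (1 - c t² / 2) u + O(t³)` in `L¹`.
The solvability condition at order `t²` forces `c = ∫ φ² h + 2 ∫ φ A`, and the same number is the
linear growth rate of the second moments of the Birkhoff sums
(`tendsto_integral_birkhoffSum_sq_mul`), so it is real and nonnegative. With `t = s / √n`, the `n`
errors add up to `O(n t³) = O(n^(-1/2))`, while `(1 - c t² / 2) ^ n` tends to `exp (-c s² / 2)`.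

Two probability densities in `B` differ by some `w - P w`, which contributes only `O(t)` to
characteristic functions; hence the limit law is the same for all `ν`. Lévy's theorem concludes.
Positivity of the invariant density comes from averaging `m (T⁻ᵏ s)`, again with a coboundary as the
error. -/

namespace TransferCLT

/-! ### Duality for the transfer operator. -/

section Transfer

variable {X : Type*} [MeasurableSpace X] {m : Measure X} {T : X → X}

/-- The defining property of the transfer operator, on sets. -/
theorem setIntegral_perronFrobenius [IsFiniteMeasure m] (hT : Measure.QuasiMeasurePreserving T m m)
    {f : X → ℂ} (hf : Integrable f m) {s : Set X} (hs : MeasurableSet s) :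
    ∫ x in s, perronFrobenius m T f x ∂m = ∫ x in T ⁻¹' s, f x ∂m := by
  set c : ComplexMeasure X := (m.withDensityᵥ f).map T with hc
  have hcs : ∀ s, MeasurableSet s → c s = ∫ x in T ⁻¹' s, f x ∂m := fun s hs => by
    rw [hc, VectorMeasure.map_apply _ hT.measurable hs,
      withDensityᵥ_apply hf (hT.measurable hs)]
  have hzero : ∀ s, MeasurableSet s → m s = 0 → c s = 0 := fun s hs h0 => by
    rw [hcs s hs, Measure.restrict_eq_zero.2 (hT.preimage_null h0), integral_zero_measure]
  -- Non-singularity of `T` rules out a singular part, so the Radon–Nikodym derivative recovers all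
  -- of `c`.
  have hre : c.re ≪ᵥ m.toENNRealVectorMeasure := by
    refine VectorMeasure.AbsolutelyContinuous.mk fun s hs h0 => ?_
    rw [Measure.toENNRealVectorMeasure_apply_measurable hs] at h0
    change (c s).re = 0
    rw [hzero s hs h0, Complex.zero_re]
  have him : c.im ≪ᵥ m.toENNRealVectorMeasure := by
    refine VectorMeasure.AbsolutelyContinuous.mk fun s hs h0 => ?_
    rw [Measure.toENNRealVectorMeasure_apply_measurable hs] at h0
    change (c s).im = 0
    rw [hzero s hs h0, Complex.zero_im]
  have hint := (c.integrable_rnDeriv m).integrableOn (s := s)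
  rw [← hcs s hs]
  change ∫ x in s, c.rnDeriv m x ∂m = c s
  apply Complex.ext
  · rw [← RCLike.re_eq_complex_re, ← integral_re hint]
    change ∫ x in s, c.re.rnDeriv m x ∂m = c.re s
    rw [← withDensityᵥ_apply (SignedMeasure.integrable_rnDeriv _ _) hs,
      SignedMeasure.withDensityᵥ_rnDeriv_eq _ _ hre]
  · rw [← RCLike.im_eq_complex_im, ← integral_im hint]
    change ∫ x in s, c.im.rnDeriv m x ∂m = c.im s
    rw [← withDensityᵥ_apply (SignedMeasure.integrable_rnDeriv _ _) hs,
      SignedMeasure.withDensityᵥ_rnDeriv_eq _ _ him]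

/-- `p` is the image of `f` under the transfer operator, in duality with `L^∞`. -/
structure IsTransfer (m : Measure X) (T : X → X) (f p : X → ℂ) : Prop where
  left : Integrable f m
  right : Integrable p m
  dual : ∀ g : X → ℂ, MemLp g ∞ m → ∫ x, g x * p x ∂m = ∫ x, g (T x) * f x ∂m

theorem exists_bound {E : Type*} [NormedAddCommGroup E] {g : X → E} (hg : MemLp g ∞ m) :
    ∃ K, 0 ≤ K ∧ ∀ᵐ x ∂m, ‖g x‖ ≤ K := by
  refine ⟨(eLpNorm g ∞ m).toReal, ENNReal.toReal_nonneg, ?_⟩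
  filter_upwards [ae_le_eLpNormEssSup (f := g) (μ := m)] with x hx
  rw [eLpNorm_exponent_top]
  have := hg.2.ne
  rw [eLpNorm_exponent_top] at this
  simpa using ENNReal.toReal_mono this hx

theorem memLp_top_comp (hT : Measure.QuasiMeasurePreserving T m m) {E : Type*}
    [NormedAddCommGroup E] {g : X → E} (hg : MemLp g ∞ m) : MemLp (fun x => g (T x)) ∞ m := by
  obtain ⟨K, -, hK⟩ := exists_bound hg
  exact memLp_top_of_bound (hg.1.comp_quasiMeasurePreserving hT) K (hT.ae hK)

theorem integrable_mul {g f : X → ℂ} (hg : MemLp g ∞ m) (hf : Integrable f m) :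
    Integrable (fun x => g x * f x) m := by
  obtain ⟨K, -, hK⟩ := exists_bound hg
  exact hf.bdd_mul hg.1 hK

/-- Linearity gives the duality for simple functions, and uniformly bounded simple approximations
pass to the limit by dominated convergence. Null sets pull back to null sets, so the approximation
also converges along `T`. -/
theorem isTransfer_of_setIntegral [IsFiniteMeasure m] (hT : Measure.QuasiMeasurePreserving T m m)
    {f p : X → ℂ} (hf : Integrable f m) (hp : Integrable p m)
    (h : ∀ s, MeasurableSet s → ∫ x in s, p x ∂m = ∫ x in T ⁻¹' s, f x ∂m) :
    IsTransfer m T f p := by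
  refine ⟨hf, hp, fun g hg => ?_⟩
  obtain ⟨K, hK0, hK⟩ := exists_bound hg
  have hsimple : ∀ φ : SimpleFunc X ℂ,
      ∫ x, φ x * p x ∂m = ∫ x, φ (T x) * f x ∂m := by
    intro φ
    have e1 : ∀ x, φ x = ∑ y ∈ φ.range, (φ ⁻¹' {y}).indicator (fun _ => y) x := by
      intro x
      rw [Finset.sum_eq_single (φ x)]
      · simp
      · intro b _ hb
        rw [Set.indicator_of_notMem]
        simpa using hb.symm
      · intro hx
        exact absurd (SimpleFunc.mem_range_self φ x) hx
    -- Used with `S = id` for `p` and with `S = T` for `f`.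
    have e2 : ∀ (q : X → ℂ) (S : X → X) x, φ (S x) * q x =
        ∑ y ∈ φ.range, (S ⁻¹' (φ ⁻¹' {y})).indicator (fun x => y * q x) x := by
      intro q S x
      rw [e1 (S x), Finset.sum_mul]
      refine Finset.sum_congr rfl fun y _ => ?_
      by_cases hx : S x ∈ φ ⁻¹' {y}
      · rw [Set.indicator_of_mem hx, Set.indicator_of_mem (by exact hx)]
      · rw [Set.indicator_of_notMem hx, Set.indicator_of_notMem (by exact hx), zero_mul]
    have hm : ∀ y, MeasurableSet (φ ⁻¹' {y}) := fun y => φ.measurableSet_fiber y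
    have e3 : ∫ x, φ x * p x ∂m = ∑ y ∈ φ.range, y * ∫ x in φ ⁻¹' {y}, p x ∂m := by
      refine (integral_congr_ae (ae_of_all _ (e2 p id))).trans ?_
      simp only [Set.preimage_id]
      rw [integral_finsetSum _ fun y _ => (hp.const_mul y).indicator (hm y)]
      refine Finset.sum_congr rfl fun y _ => ?_
      rw [integral_indicator (hm y), integral_const_mul]
    have e4 : ∫ x, φ (T x) * f x ∂m = ∑ y ∈ φ.range, y * ∫ x in T ⁻¹' (φ ⁻¹' {y}), f x ∂m := by
      refine (integral_congr_ae (ae_of_all _ (e2 f T))).trans ?_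
      rw [integral_finsetSum _ fun y _ => (hf.const_mul y).indicator (hT.measurable (hm y))]
      refine Finset.sum_congr rfl fun y _ => ?_
      rw [integral_indicator (hT.measurable (hm y)), integral_const_mul]
    rw [e3, e4]
    exact Finset.sum_congr rfl fun y _ => by rw [h _ (hm y)]
  set g' := hg.1.mk g with hg'
  have hgm : StronglyMeasurable g' := hg.1.stronglyMeasurable_mk
  have hgg : g =ᵐ[m] g' := hg.1.ae_eq_mk
  have hK' : ∀ᵐ x ∂m, ‖g' x‖ ≤ K := by
    filter_upwards [hK, hgg] with x h1 h2
    rwa [← h2]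
  have t1 : Tendsto (fun n => ∫ x, hgm.approxBounded K n x * p x ∂m) atTop
      (𝓝 (∫ x, g' x * p x ∂m)) := by
    refine tendsto_integral_of_dominated_convergence (fun x => K * ‖p x‖)
      (fun n => ((SimpleFunc.stronglyMeasurable _).aestronglyMeasurable).mul hp.1)
      (hp.norm.const_mul K) (fun n => ae_of_all _ fun x => ?_) ?_
    · rw [norm_mul]
      gcongr
      exact hgm.norm_approxBounded_le hK0 n x
    · filter_upwards [hgm.tendsto_approxBounded_ae hK'] with x hx using hx.mul_const _
  have t2 : Tendsto (fun n => ∫ x, hgm.approxBounded K n (T x) * f x ∂m) atTop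
      (𝓝 (∫ x, g' (T x) * f x ∂m)) := by
    refine tendsto_integral_of_dominated_convergence (fun x => K * ‖f x‖)
      (fun n => (((SimpleFunc.stronglyMeasurable _).comp_measurable
        hT.measurable).aestronglyMeasurable).mul hf.1)
      (hf.norm.const_mul K) (fun n => ae_of_all _ fun x => ?_) ?_
    · rw [norm_mul]
      gcongr
      exact hgm.norm_approxBounded_le hK0 n _
    · filter_upwards [hT.ae (hgm.tendsto_approxBounded_ae hK')] with x hx using hx.mul_const _
  simp_rw [hsimple] at t1
  have key := tendsto_nhds_unique t1 t2
  calc ∫ x, g x * p x ∂m = ∫ x, g' x * p x ∂m :=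
        integral_congr_ae (by filter_upwards [hgg] with x hx; rw [hx])
    _ = ∫ x, g' (T x) * f x ∂m := key
    _ = ∫ x, g (T x) * f x ∂m :=
        integral_congr_ae (by filter_upwards [hT.ae hgg] with x hx; rw [hx])

theorem isTransfer_perronFrobenius [IsFiniteMeasure m]
    (hT : Measure.QuasiMeasurePreserving T m m) {f : X → ℂ} (hf : Integrable f m) :
    IsTransfer m T f (perronFrobenius m T f) :=
  isTransfer_of_setIntegral hT hf (ComplexMeasure.integrable_rnDeriv _ _)
    fun _ hs => setIntegral_perronFrobenius hT hf hs

namespace IsTransfer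

variable {f p f' p' : X → ℂ}

theorem congr (h : IsTransfer m T f p) (hf : f =ᵐ[m] f') (hp : p =ᵐ[m] p') :
    IsTransfer m T f' p' := by
  refine ⟨h.left.congr hf, h.right.congr hp, fun g hg => ?_⟩
  calc ∫ x, g x * p' x ∂m = ∫ x, g x * p x ∂m :=
        integral_congr_ae (by filter_upwards [hp] with x hx; rw [hx])
    _ = ∫ x, g (T x) * f x ∂m := h.dual g hg
    _ = ∫ x, g (T x) * f' x ∂m :=
        integral_congr_ae (by filter_upwards [hf] with x hx; rw [hx])

theorem const_mul (h : IsTransfer m T f p) (c : ℂ) :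
    IsTransfer m T (fun x => c * f x) (fun x => c * p x) := by
  refine ⟨h.left.const_mul c, h.right.const_mul c, fun g hg => ?_⟩
  simp_rw [mul_left_comm _ c, integral_const_mul, h.dual g hg]

theorem add (hT : Measure.QuasiMeasurePreserving T m m) (h : IsTransfer m T f p)
    (h' : IsTransfer m T f' p') :
    IsTransfer m T (fun x => f x + f' x) (fun x => p x + p' x) := by
  refine ⟨h.left.add h'.left, h.right.add h'.right, fun g hg => ?_⟩
  simp_rw [mul_add]
  rw [integral_add (integrable_mul hg h.right) (integrable_mul hg h'.right),
    integral_add (integrable_mul (memLp_top_comp hT hg) h.left)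
      (integrable_mul (memLp_top_comp hT hg) h'.left), h.dual g hg, h'.dual g hg]

theorem integral_eq (h : IsTransfer m T f p) : ∫ x, p x ∂m = ∫ x, f x ∂m := by
  simpa using h.dual (fun _ => 1) (memLp_top_const 1)

theorem setIntegral_eq (h : IsTransfer m T f p) (hT : Measurable T) {s : Set X}
    (hs : MeasurableSet s) :
    ∫ x in s, p x ∂m = ∫ x in T ⁻¹' s, f x ∂m := by
  have := h.dual (s.indicator fun _ => 1) ((memLp_top_const 1).indicator hs)
  rw [← integral_indicator hs, ← integral_indicator (hT hs)]
  convert this using 2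
  · ext x; by_cases hx : x ∈ s <;> simp [hx]
  · ext x; by_cases hx : T x ∈ s <;> simp [hx]

end IsTransfer

end Transfer

/-! ### The spectral projection at the eigenvalue one. -/

section Spectral

variable {B : Type*} [NormedAddCommGroup B] [NormedSpace ℂ B]

/-- If `P` is quasi-compact of diagonal type with no peripheral eigenvalue besides `1`, there is a
projection `E` onto fixed points of `P` such that `1 - P` maps `ker E` onto itself. -/
theorem IsQuasiCompactDiagonal.exists_projection [CompleteSpace B] {P : B →L[ℂ] B}
    (hP : IsQuasiCompactDiagonal P)
    (h1 : ∀ z : ℂ, Module.End.HasEigenvalue (P : B →ₗ[ℂ] B) z → ‖z‖ = 1 → z = 1) :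
    ∃ E : B →L[ℂ] B, (∀ x, P (E x) = E x) ∧ (∀ x, E (E x) = E x) ∧
      ∀ g, E g = 0 → ∃ w, E w = 0 ∧ w - P w = g := by
  obtain ⟨s, lam, Proj, Q, hPeq, hlam, hproj, -, horth, hQ, hrad⟩ := hP
  have hPP : ∀ i, P * Proj i = lam i • Proj i := by
    intro i
    rw [hPeq, add_mul, (hQ i).1, add_zero, Finset.sum_mul,
      Finset.sum_eq_single i, smul_mul_assoc, hproj i]
    · intro j _ hj
      rw [smul_mul_assoc, horth j i hj, smul_zero]
    · simp
  -- A nonzero `Proj i` makes `lam i` a peripheral eigenvalue, hence `1`. If `Proj i = 0`, the value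
  -- of `lam i` is irrelevant.
  have hone : ∀ i, lam i • Proj i = Proj i := by
    intro i
    by_cases h0 : Proj i = 0
    · rw [h0, smul_zero]
    · obtain ⟨x, hx⟩ : ∃ x, Proj i x ≠ 0 := by
        by_contra! hcon
        exact h0 (ContinuousLinearMap.ext hcon)
      have hev : Module.End.HasEigenvalue (P : B →ₗ[ℂ] B) (lam i) :=
        Module.End.hasEigenvalue_of_hasEigenvector (x := Proj i x)
          ⟨Module.End.mem_eigenspace_iff.2 (DFunLike.congr_fun (hPP i) x), hx⟩
      rw [h1 _ hev (hlam i), one_smul]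
  simp_rw [hone] at hPeq
  set E := ∑ i, Proj i with hE
  have hEE : E * E = E := by
    rw [hE, Finset.sum_mul]
    refine Finset.sum_congr rfl fun i _ => ?_
    rw [Finset.mul_sum, Finset.sum_eq_single i, hproj i]
    · intro j _ hj
      exact horth i j hj.symm
    · simp
  have hQE : Q * E = 0 := by
    rw [hE, Finset.mul_sum]
    exact Finset.sum_eq_zero fun i _ => (hQ i).1
  have hEQ : E * Q = 0 := by
    rw [hE, Finset.sum_mul]
    exact Finset.sum_eq_zero fun i _ => (hQ i).2
  have hunit : IsUnit (1 - Q) := by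
    have : (1 : ℂ) ∈ resolventSet ℂ Q :=
      spectrum.mem_resolventSet_of_spectralRadius_lt (by simpa using hrad)
    simpa [resolventSet] using this
  obtain ⟨R, hR⟩ := hunit.exists_right_inv
  -- The inverse `R` of `1 - Q` thus preserves `ker E`, where `P` and `Q` coincide.
  have hER : E * R = E := by
    have h := congrArg (E * ·) hR
    simpa [← mul_assoc, mul_sub, hEQ] using h
  refine ⟨E, fun x => ?_, fun x => DFunLike.congr_fun hEE x, fun g hg => ⟨R g, ?_, ?_⟩⟩
  · have : P * E = E := by rw [hPeq, add_mul, hEE, hQE, add_zero]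
    exact DFunLike.congr_fun this x
  · rw [← hg]
    exact DFunLike.congr_fun hER g
  · have h := DFunLike.congr_fun hR g
    have h0 : E (R g) = 0 := (DFunLike.congr_fun hER g).trans hg
    rw [hPeq]
    simpa [h0] using h

end Spectral

/-! ### The space `B` and its cohomological equation. -/

section Space

variable {X : Type*} [MeasurableSpace X] {m : Measure X}
  {B : Type*} [NormedAddCommGroup B] [NormedSpace ℂ B] {ι : B →L[ℂ] Lp ℂ 1 m}

namespace InSpace

variable {f g : X → ℂ}

theorem integrable (hf : InSpace ι f) : Integrable f m := by
  obtain ⟨b, hb⟩ := hf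
  exact (L1.integrable_coeFn (ι b)).congr hb

theorem congr (hf : InSpace ι f) (h : f =ᵐ[m] g) : InSpace ι g := by
  obtain ⟨b, hb⟩ := hf
  exact ⟨b, hb.trans h⟩

theorem add (hf : InSpace ι f) (hg : InSpace ι g) : InSpace ι fun x => f x + g x := by
  obtain ⟨b, hb⟩ := hf
  obtain ⟨c, hc⟩ := hg
  refine ⟨b + c, ?_⟩
  rw [map_add]
  filter_upwards [Lp.coeFn_add (ι b) (ι c), hb, hc] with x h1 h2 h3
  rw [h1, Pi.add_apply, h2, h3]

theorem sub (hf : InSpace ι f) (hg : InSpace ι g) : InSpace ι fun x => f x - g x := by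
  obtain ⟨b, hb⟩ := hf
  obtain ⟨c, hc⟩ := hg
  refine ⟨b - c, ?_⟩
  rw [map_sub]
  filter_upwards [Lp.coeFn_sub (ι b) (ι c), hb, hc] with x h1 h2 h3
  rw [h1, Pi.sub_apply, h2, h3]

theorem const_mul (hf : InSpace ι f) (c : ℂ) : InSpace ι fun x => c * f x := by
  obtain ⟨b, hb⟩ := hf
  refine ⟨c • b, ?_⟩
  rw [map_smul]
  filter_upwards [Lp.coeFn_smul c (ι b), hb] with x h1 h2
  rw [h1, Pi.smul_apply, h2, smul_eq_mul]

end InSpace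

namespace IsAdmissible

variable {T : X → X} {P : B →L[ℂ] B}

theorem mul (hB : IsAdmissible ι T P) {f g : X → ℂ} (hf : InSpace ι f) (hg : InSpace ι g) :
    InSpace ι fun x => f x * g x := by
  obtain ⟨b, hb⟩ := hf
  obtain ⟨c, hc⟩ := hg
  obtain ⟨C, -, hC⟩ := hB.mul_mem
  obtain ⟨d, hd, -⟩ := hC b c
  refine ⟨d, ?_⟩
  filter_upwards [hd, hb, hc] with x h1 h2 h3
  rw [h1, h2, h3]

theorem isTransfer [IsFiniteMeasure m] (hB : IsAdmissible ι T P) (hT : Measure.QuasiMeasurePreserving T m m) (b : B) :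
    IsTransfer m T (ι b) (ι (P b)) :=
  (isTransfer_perronFrobenius hT (L1.integrable_coeFn (ι b))).congr (ae_eq_refl _)
    (hB.transfer b).symm

theorem integral_sub_apply (ι : B →L[ℂ] Lp ℂ 1 m) (b c : B) :
    ∫ x, ι (b - c) x ∂m = ∫ x, ι b x ∂m - ∫ x, ι c x ∂m := by
  rw [← integral_sub (L1.integrable_coeFn _) (L1.integrable_coeFn _), map_sub]
  exact integral_congr_ae (Lp.coeFn_sub (ι b) (ι c))

theorem integral_smul_apply (ι : B →L[ℂ] Lp ℂ 1 m) (c : ℂ) (b : B) :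
    ∫ x, ι (c • b) x ∂m = c * ∫ x, ι b x ∂m := by
  rw [← integral_const_mul, map_smul]
  exact integral_congr_ae (Lp.coeFn_smul c (ι b))

/-- Elements of `B` fixed by `P` are determined by their integral. -/
theorem eq_of_fixed (hB : IsAdmissible ι T P) {b c : B} (hb : P b = b) (hc : P c = c)
    (hb1 : ∫ x, ι b x ∂m = 1) (hc1 : ∫ x, ι c x ∂m = 1) : b = c := by
  have hb0 : b ≠ 0 := by
    rintro rfl
    have : ∫ x, ι ((0 : ℂ) • (0 : B)) x ∂m = 0 := by rw [integral_smul_apply, zero_mul]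
    rw [smul_zero, hb1] at this
    exact one_ne_zero this
  have hmem : ∀ {d}, P d = d → d ∈ Module.End.eigenspace (P : B →ₗ[ℂ] B) 1 := fun {d} hd =>
    Module.End.mem_eigenspace_iff.2 (by rw [one_smul]; exact hd)
  obtain ⟨z, hz⟩ := (finrank_eq_one_iff_of_nonzero' (⟨b, hmem hb⟩ :
    Module.End.eigenspace (P : B →ₗ[ℂ] B) 1) (by simpa using hb0)).1 hB.simple_one ⟨c, hmem hc⟩
  have hz' : z • b = c := congrArg Subtype.val hz
  have : z = 1 := by
    have h := integral_smul_apply ι z b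
    rwa [hz', hb1, hc1, mul_one, eq_comm] at h
  rw [← hz', this, one_smul]

variable [CompleteSpace B] [IsProbabilityMeasure m]

/-- The spectral projection at the eigenvalue `1` in terms of the invariant density `h`. -/
theorem exists_fixed (hB : IsAdmissible ι T P) (hT : Measure.QuasiMeasurePreserving T m m) :
    ∃ h : B, P h = h ∧ ∫ x, ι h x ∂m = 1 ∧
      ∀ g : B, ∃ w : B, ∫ x, ι w x ∂m = 0 ∧ w - P w = g - (∫ x, ι g x ∂m) • h := by
  obtain ⟨E, hPE, hEE, hker⟩ := hB.quasiCompact.exists_projection hB.unique_one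
  -- `b - E b` lies in `ker E`, so it is some `w - P w`, and `P` preserves integrals.
  have hint : ∀ b, ∫ x, ι (E b) x ∂m = ∫ x, ι b x ∂m := by
    intro b
    obtain ⟨w, -, hw⟩ := hker (b - E b) (by rw [map_sub, hEE, sub_self])
    have h1 := integral_sub_apply ι b (E b)
    rw [← hw, integral_sub_apply, (hB.isTransfer hT w).integral_eq, sub_self] at h1
    exact (sub_eq_zero.1 h1.symm).symm
  obtain ⟨e, he⟩ := hB.const_mem 1
  have he1 : ∫ x, ι e x ∂m = 1 := by
    rw [integral_congr_ae he]; simp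
  have hmem : ∀ d, E d ∈ Module.End.eigenspace (P : B →ₗ[ℂ] B) 1 := fun d =>
    Module.End.mem_eigenspace_iff.2 (by rw [one_smul]; exact hPE d)
  have hE0 : E e ≠ 0 := by
    intro h0
    have h1 : ∫ x, ι ((0 : ℂ) • (0 : B)) x ∂m = 0 := by rw [integral_smul_apply, zero_mul]
    rw [smul_zero, ← h0, hint, he1] at h1
    exact one_ne_zero h1
  -- The range of `E` lies in the one-dimensional fixed space spanned by `E e`; comparing integrals
  -- identifies the coefficient.
  have hE : ∀ g, E g = (∫ x, ι g x ∂m) • E e := by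
    intro g
    obtain ⟨z, hz⟩ := (finrank_eq_one_iff_of_nonzero' (⟨E e, hmem e⟩ :
      Module.End.eigenspace (P : B →ₗ[ℂ] B) 1) (by simpa using hE0)).1 hB.simple_one ⟨E g, hmem g⟩
    have hz' : z • E e = E g := congrArg Subtype.val hz
    rw [← hint g, ← hz', integral_smul_apply, hint, he1, mul_one]
  refine ⟨E e, hPE e, by rw [hint, he1], fun g => ?_⟩
  obtain ⟨w, hw0, hw⟩ := hker (g - E g) (by rw [map_sub, hEE, sub_self])
  refine ⟨w, ?_, by rw [hw, hE g]⟩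
  rw [← hint, hw0]
  have h1 : ∫ x, ι ((0 : ℂ) • (0 : B)) x ∂m = 0 := by rw [integral_smul_apply, zero_mul]
  rwa [smul_zero] at h1

/-- Functions of `B` with zero integral are coboundaries for the transfer operator. -/
theorem exists_isTransfer_sub (hB : IsAdmissible ι T P)
    (hT : Measure.QuasiMeasurePreserving T m m) {f : X → ℂ} (hf : InSpace ι f)
    (h0 : ∫ x, f x ∂m = 0) :
    ∃ w : X → ℂ, InSpace ι w ∧ ∫ x, w x ∂m = 0 ∧ IsTransfer m T w (fun x => w x - f x) := by
  obtain ⟨h, -, -, hall⟩ := hB.exists_fixed hT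
  obtain ⟨b, hb⟩ := hf
  obtain ⟨w, hw0, hw⟩ := hall b
  rw [integral_congr_ae hb, h0, zero_smul, sub_zero] at hw
  have hPw : P w = w - b := by rw [← hw]; abel
  refine ⟨ι w, ⟨w, ae_eq_refl _⟩, hw0, (hB.isTransfer hT w).congr (ae_eq_refl _) ?_⟩
  rw [hPw, map_sub]
  filter_upwards [Lp.coeFn_sub (ι w) (ι b), hb] with x h1 h2
  rw [h1, Pi.sub_apply, h2]

end IsAdmissible

end Space

/-! ### Elementary bounds and identities. -/

theorem norm_exp_sub_one_le (x : ℝ) : ‖Complex.exp (x * Complex.I) - 1‖ ≤ |x| := by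
  rw [mul_comm]
  exact Real.norm_exp_I_mul_ofReal_sub_one_le

theorem norm_exp_sub_exp_le (x y : ℝ) :
    ‖Complex.exp (x * Complex.I) - Complex.exp (y * Complex.I)‖ ≤ |x - y| := by
  have h : Complex.exp (x * Complex.I) - Complex.exp (y * Complex.I) =
      Complex.exp (y * Complex.I) * (Complex.exp ((x - y : ℝ) * Complex.I) - 1) := by
    rw [mul_sub, ← Complex.exp_add, mul_one]
    congr 2
    push_cast
    ring
  rw [h, norm_mul, Complex.norm_exp_ofReal_mul_I, one_mul]
  exact norm_exp_sub_one_le _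

theorem norm_exp_sub_one_sub_le {x : ℝ} (hx : |x| ≤ 1) :
    ‖Complex.exp (x * Complex.I) - 1 - x * Complex.I‖ ≤ |x| ^ 2 := by
  have h : ‖(x * Complex.I : ℂ)‖ = |x| := by simp
  rw [← h]
  exact Complex.norm_exp_sub_one_sub_id_le (by rwa [h])

theorem norm_exp_sub_taylor_two_le {x : ℝ} (hx : |x| ≤ 1) :
    ‖Complex.exp (x * Complex.I) - 1 - x * Complex.I + x ^ 2 / 2‖ ≤ |x| ^ 3 := by
  have h : ‖(x * Complex.I : ℂ)‖ = |x| := by simp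
  have h3 := Complex.exp_bound (x := x * Complex.I) (by rwa [h]) (n := 3) (by norm_num)
  rw [h] at h3
  have e : Complex.exp (x * Complex.I) - 1 - x * Complex.I + x ^ 2 / 2 =
      Complex.exp (x * Complex.I) - ∑ k ∈ Finset.range 3, (x * Complex.I) ^ k / k.factorial := by
    simp only [Finset.sum_range_succ, Finset.sum_range_zero, mul_pow, Complex.I_sq]
    norm_num [Nat.factorial]
    ring
  rw [e]
  refine h3.trans ?_
  have : (0 : ℝ) ≤ |x| ^ 3 := by positivity
  norm_num [Nat.factorial]
  linarith

/-- One-step errors add up without amplification because `‖q‖ ≤ 1`. -/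
theorem norm_sub_pow_mul_le {z : ℕ → ℂ} {q : ℂ} {ε : ℝ} (hq : ‖q‖ ≤ 1)
    (h : ∀ n, ‖z (n + 1) - q * z n‖ ≤ ε) (n : ℕ) : ‖z n - q ^ n * z 0‖ ≤ n * ε := by
  induction n with
  | zero => simp
  | succ n ih =>
    calc ‖z (n + 1) - q ^ (n + 1) * z 0‖
        = ‖(z (n + 1) - q * z n) + q * (z n - q ^ n * z 0)‖ := by congr 1; ring
      _ ≤ ‖z (n + 1) - q * z n‖ + ‖q‖ * ‖z n - q ^ n * z 0‖ := by
          rw [← norm_mul]; exact norm_add_le _ _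
      _ ≤ ε + 1 * (n * ε) := by gcongr; exact h n
      _ = (n + 1 : ℕ) * ε := by push_cast; ring

theorem birkhoffSum_comp {X : Type*} (T : X → X) (φ : X → ℝ) (n : ℕ) (x : X) :
    birkhoffSum T φ n (T x) = birkhoffSum T φ n x + φ (T^[n] x) - φ x := by
  have h1 := birkhoffSum_succ T φ n x
  have h2 := birkhoffSum_succ' T φ n x
  linarith

/-! ### Characteristic functions of Birkhoff sums. -/

section CharIntegral

variable {X : Type*} [MeasurableSpace X] {m : Measure X} {T : X → X} {φ : X → ℝ}

theorem memLp_top_birkhoffSum (hT : Measure.QuasiMeasurePreserving T m m) (hφ : MemLp φ ∞ m)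
    (n : ℕ) : MemLp (birkhoffSum T φ n) ∞ m := by
  induction n with
  | zero => simp [birkhoffSum_zero']
  | succ n ih =>
    have : birkhoffSum T φ (n + 1) = fun x => φ x + birkhoffSum T φ n (T x) := by
      ext x; exact birkhoffSum_succ' T φ n x
    rw [this]
    exact hφ.add (memLp_top_comp hT ih)

theorem memLp_top_iterate (hT : Measure.QuasiMeasurePreserving T m m) (hφ : MemLp φ ∞ m)
    (n : ℕ) : MemLp (fun x => φ (T^[n] x)) ∞ m :=
  memLp_top_comp (hT.iterate n) hφ

theorem memLp_top_exp {F : X → ℝ} (hF : AEStronglyMeasurable F m) (t : ℝ) :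
    MemLp (fun x => Complex.exp ((t * F x : ℝ) * Complex.I)) ∞ m := by
  refine memLp_top_of_bound ?_ 1 (ae_of_all _ fun x => (Complex.norm_exp_ofReal_mul_I _).le)
  have : Continuous fun y : ℝ => Complex.exp ((t * y : ℝ) * Complex.I) := by fun_prop
  exact this.comp_aestronglyMeasurable hF

theorem norm_integral_exp_mul_le (F : X → ℝ) (f : X → ℂ) :
    ‖∫ x, Complex.exp (F x * Complex.I) * f x ∂m‖ ≤ ∫ x, ‖f x‖ ∂m := by
  refine (norm_integral_le_integral_norm _).trans (le_of_eq ?_)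
  simp_rw [norm_mul, Complex.norm_exp_ofReal_mul_I, one_mul]

/-- The characteristic function at `t` of the `n`-th Birkhoff sum under the density `f`. -/
noncomputable def charIntegral (m : Measure X) (T : X → X) (φ : X → ℝ) (t : ℝ) (n : ℕ)
    (f : X → ℂ) : ℂ :=
  ∫ x, Complex.exp ((t * birkhoffSum T φ n x : ℝ) * Complex.I) * f x ∂m

theorem norm_charIntegral_le (t : ℝ) (n : ℕ) (f : X → ℂ) :
    ‖charIntegral m T φ t n f‖ ≤ ∫ x, ‖f x‖ ∂m :=
  norm_integral_exp_mul_le _ f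

theorem charIntegral_zero (t : ℝ) (f : X → ℂ) : charIntegral m T φ t 0 f = ∫ x, f x ∂m := by
  simp [charIntegral]

theorem integrable_exp_mul (hT : Measure.QuasiMeasurePreserving T m m) (hφ : MemLp φ ∞ m)
    (t : ℝ) (n : ℕ) {f : X → ℂ} (hf : Integrable f m) :
    Integrable (fun x => Complex.exp ((t * birkhoffSum T φ n x : ℝ) * Complex.I) * f x) m :=
  integrable_mul (memLp_top_exp (memLp_top_birkhoffSum hT hφ n).1 t) hf

theorem charIntegral_sub (hT : Measure.QuasiMeasurePreserving T m m) (hφ : MemLp φ ∞ m)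
    (t : ℝ) (n : ℕ) {f g : X → ℂ} (hf : Integrable f m) (hg : Integrable g m) :
    charIntegral m T φ t n (fun x => f x - g x) =
      charIntegral m T φ t n f - charIntegral m T φ t n g := by
  rw [charIntegral, charIntegral, charIntegral, ← integral_sub
    (integrable_exp_mul hT hφ t n hf) (integrable_exp_mul hT hφ t n hg)]
  simp_rw [mul_sub]

theorem charIntegral_const_mul (t : ℝ) (n : ℕ) (c : ℂ) (f : X → ℂ) :
    charIntegral m T φ t n (fun x => c * f x) = c * charIntegral m T φ t n f := by
  rw [charIntegral, charIntegral, ← integral_const_mul]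
  simp_rw [mul_left_comm]

theorem charIntegral_transfer (hT : Measure.QuasiMeasurePreserving T m m) (hφ : MemLp φ ∞ m)
    (t : ℝ) (n : ℕ) {f p : X → ℂ} (h : IsTransfer m T f p) :
    charIntegral m T φ t n p =
      ∫ x, Complex.exp ((t * birkhoffSum T φ n (T x) : ℝ) * Complex.I) * f x ∂m :=
  h.dual _ (memLp_top_exp (memLp_top_birkhoffSum hT hφ n).1 t)

theorem charIntegral_succ (t : ℝ) (n : ℕ) (f : X → ℂ) :
    charIntegral m T φ t (n + 1) f =
      ∫ x, Complex.exp ((t * birkhoffSum T φ n (T x) : ℝ) * Complex.I) *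
        (Complex.exp ((t * φ x : ℝ) * Complex.I) * f x) ∂m := by
  rw [charIntegral]
  refine integral_congr_ae (ae_of_all _ fun x => ?_)
  simp only []
  rw [← mul_assoc, ← Complex.exp_add, birkhoffSum_succ']
  congr 2
  push_cast
  ring

/-- Coboundaries for the transfer operator are negligible for the characteristic functions. -/
theorem norm_charIntegral_coboundary_le (hT : Measure.QuasiMeasurePreserving T m m)
    (hφ : MemLp φ ∞ m) {K : ℝ} (hK : ∀ᵐ x ∂m, ‖φ x‖ ≤ K) {w p : X → ℂ} (h : IsTransfer m T w p)
    (t : ℝ) (n : ℕ) :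
    ‖charIntegral m T φ t n (fun x => w x - p x)‖ ≤ |t| * (2 * K * ∫ x, ‖w x‖ ∂m) := by
  -- Duality moves the transfer operator onto the exponential. The two phases then differ by `t (φ -
  -- φ ∘ T^[n])`, at most `2 K |t|` whatever `n` is.
  rw [charIntegral_sub hT hφ t n h.left h.right, charIntegral_transfer hT hφ t n h, charIntegral,
    ← integral_sub (integrable_exp_mul hT hφ t n h.left) (integrable_mul (memLp_top_comp hT
      (memLp_top_exp (memLp_top_birkhoffSum hT hφ n).1 t)) h.left)]
  rw [← integral_const_mul, ← integral_const_mul]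
  refine norm_integral_le_of_norm_le ((h.left.norm.const_mul _).const_mul _) ?_
  filter_upwards [hK, (hT.iterate n).ae hK] with x h1 h2
  rw [← sub_mul, norm_mul, ← mul_assoc]
  gcongr
  refine (norm_exp_sub_exp_le _ _).trans ?_
  rw [← mul_sub, abs_mul]
  gcongr
  rw [birkhoffSum_comp]
  rw [Real.norm_eq_abs] at h1 h2
  rw [abs_le] at h1 h2 ⊢
  constructor <;> linarith [h1.1, h1.2, h2.1, h2.2]

/-- The functions `h`, `A`, `b` are the coefficients of a second order approximation of the
dominant eigenfunction of the twisted transfer operators `f ↦ P (exp (i t φ) f)`, and `1 - c t² / 2`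
is the corresponding approximate eigenvalue. -/
structure IsSecondOrder (m : Measure X) (T : X → X) (φ : X → ℝ) (c : ℂ) (h A b : X → ℂ) :
    Prop where
  zeroth : IsTransfer m T h h
  first : IsTransfer m T (fun x => φ x * h x + A x) A
  second : IsTransfer m T
    (fun x => b x + (c / 2 * h x - φ x * A x - (φ x : ℂ) ^ 2 / 2 * h x)) b

namespace IsSecondOrder

variable {c : ℂ} {h A b : X → ℂ}

theorem integrable_approx (H : IsSecondOrder m T φ c h A b) (t : ℝ) :
    Integrable (fun x => h x + t * Complex.I * A x + (t : ℂ) ^ 2 * b x) m :=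
  (H.zeroth.left.add (H.first.right.const_mul _)).add (H.second.right.const_mul _)

/-- The coefficient of order `t ^ j` is multiplied by a Taylor remainder of order `3 - j`, so every
error term is cubic in `t`. -/
theorem norm_exp_mul_sub_le (t : ℝ) {K r : ℝ} (ht : |t| * K ≤ 1) (hr : |r| ≤ K) (h A b : ℂ) :
    ‖Complex.exp ((t * r : ℝ) * Complex.I) * (h + t * Complex.I * A + (t : ℂ) ^ 2 * b) -
      (h + t * Complex.I * (r * h + A) + (t : ℂ) ^ 2 * (b - r * A - (r : ℂ) ^ 2 / 2 * h))‖ ≤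
      |t| ^ 3 * (K ^ 3 * ‖h‖ + K ^ 2 * ‖A‖ + K * ‖b‖) := by
  set x : ℝ := t * r with hx
  have hxK : |x| ≤ |t| * K := by rw [hx, abs_mul]; gcongr
  have hx1 : |x| ≤ 1 := hxK.trans ht
  have e : Complex.exp (x * Complex.I) * (h + t * Complex.I * A + (t : ℂ) ^ 2 * b) -
      (h + t * Complex.I * (r * h + A) + (t : ℂ) ^ 2 * (b - r * A - (r : ℂ) ^ 2 / 2 * h)) =
      (Complex.exp (x * Complex.I) - 1 - x * Complex.I + (x : ℂ) ^ 2 / 2) * h +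
      (Complex.exp (x * Complex.I) - 1 - x * Complex.I) * (t * Complex.I * A) +
      (Complex.exp (x * Complex.I) - 1) * ((t : ℂ) ^ 2 * b) := by
    have hxc : (x : ℂ) = t * r := by rw [hx]; push_cast; ring
    generalize Complex.exp (x * Complex.I) = z
    rw [hxc]
    linear_combination ((t : ℂ) ^ 2 * r * A) * Complex.I_sq
  rw [e]
  have n1 : ‖(t * Complex.I * A : ℂ)‖ = |t| * ‖A‖ := by simp
  have n2 : ‖((t : ℂ) ^ 2 * b : ℂ)‖ = |t| ^ 2 * ‖b‖ := by simp
  calc _ ≤ |x| ^ 3 * ‖h‖ + |x| ^ 2 * (|t| * ‖A‖) + |x| * (|t| ^ 2 * ‖b‖) := by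
        refine (norm_add₃_le).trans ?_
        rw [norm_mul, norm_mul _ (t * Complex.I * A : ℂ), norm_mul _ ((t : ℂ) ^ 2 * b : ℂ), n1, n2]
        gcongr
        · exact norm_exp_sub_taylor_two_le hx1
        · exact norm_exp_sub_one_sub_le hx1
        · exact norm_exp_sub_one_le x
    _ ≤ (|t| * K) ^ 3 * ‖h‖ + (|t| * K) ^ 2 * (|t| * ‖A‖) + (|t| * K) * (|t| ^ 2 * ‖b‖) := by
        gcongr
    _ = _ := by ring

/-- The approximate eigenvalue equation, tested against `exp (i t S_n)`. The constant does not
depend on `n`, because the exponential has modulus one. -/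
theorem exists_step_le (H : IsSecondOrder m T φ c h A b)
    (hT : Measure.QuasiMeasurePreserving T m m) (hφ : MemLp φ ∞ m) {K : ℝ}
    (hK : ∀ᵐ x ∂m, ‖φ x‖ ≤ K) :
    ∃ M : ℝ, ∀ t : ℝ, |t| ≤ 1 → |t| * K ≤ 1 → ∀ n,
      ‖charIntegral m T φ t (n + 1) (fun x => h x + t * Complex.I * A x + (t : ℂ) ^ 2 * b x) -
        (1 - c * (t : ℂ) ^ 2 / 2) *
        charIntegral m T φ t n (fun x => h x + t * Complex.I * A x + (t : ℂ) ^ 2 * b x)‖ ≤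
      |t| ^ 3 * M := by
  have ih := H.zeroth.left
  have iA := H.first.right
  have ib := H.second.right
  refine ⟨(∫ x, (K ^ 3 * ‖h x‖ + K ^ 2 * ‖A x‖ + K * ‖b x‖) ∂m) +
    ∫ x, ‖c‖ / 2 * (‖A x‖ + ‖b x‖) ∂m, fun t ht1 htK n => ?_⟩
  set u : X → ℂ := fun x => h x + t * Complex.I * A x + (t : ℂ) ^ 2 * b x with hu
  have hui : Integrable u m := H.integrable_approx t
  set v : X → ℂ := fun x => h x + t * Complex.I * (φ x * h x + A x) +
    (t : ℂ) ^ 2 * (b x - φ x * A x - (φ x : ℂ) ^ 2 / 2 * h x) with hv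
  have hvt : IsTransfer m T v (fun x => u x - c * (t : ℂ) ^ 2 / 2 * h x) := by
    have h1 := ((H.zeroth.const_mul (1 - c * (t : ℂ) ^ 2 / 2)).add hT
      (H.first.const_mul (t * Complex.I))).add hT (H.second.const_mul ((t : ℂ) ^ 2))
    refine h1.congr (ae_of_all _ fun x => ?_) (ae_of_all _ fun x => ?_)
    · simp only [hv]; ring
    · simp only [hu]; ring
  have ieu : Integrable (fun x => Complex.exp ((t * φ x : ℝ) * Complex.I) * u x) m :=
    integrable_mul (memLp_top_exp hφ.1 t) hui
  have hE := memLp_top_comp hT (memLp_top_exp (memLp_top_birkhoffSum hT hφ n).1 t)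
  -- The first term is the Taylor error of `exp (i t φ) u` against `v`; the second is the defect of
  -- the eigenvalue equation after transferring `v`. Both are `O(t³)`.
  have split : charIntegral m T φ t (n + 1) u - (1 - c * (t : ℂ) ^ 2 / 2) *
        charIntegral m T φ t n u =
      (∫ x, Complex.exp ((t * birkhoffSum T φ n (T x) : ℝ) * Complex.I) *
        (Complex.exp ((t * φ x : ℝ) * Complex.I) * u x - v x) ∂m) +
      charIntegral m T φ t n
        (fun x => (u x - c * (t : ℂ) ^ 2 / 2 * h x) - (1 - c * (t : ℂ) ^ 2 / 2) * u x) := by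
    rw [charIntegral_sub hT hφ t n hvt.right (hui.const_mul _), charIntegral_const_mul,
      charIntegral_transfer hT hφ t n hvt, charIntegral_succ]
    simp_rw [mul_sub (Complex.exp ((t * birkhoffSum T φ n (T _) : ℝ) * Complex.I))]
    rw [integral_sub (integrable_mul hE ieu) (integrable_mul hE hvt.left)]
    ring
  rw [split, mul_add, ← integral_const_mul, ← integral_const_mul]
  refine (norm_add_le _ _).trans (add_le_add ?_ ?_)
  · refine (norm_integral_exp_mul_le _ _).trans (integral_mono_ae (ieu.sub hvt.left).norm
      ((((ih.norm.const_mul _).add (iA.norm.const_mul _)).add (ib.norm.const_mul _)).const_mul _)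
      ?_)
    filter_upwards [hK] with x hx
    exact norm_exp_mul_sub_le t htK hx _ _ _
  · refine (norm_charIntegral_le _ _ _).trans (integral_mono_ae
      (hvt.right.sub (hui.const_mul _)).norm
      (((iA.norm.add ib.norm).const_mul _).const_mul _) (ae_of_all _ fun x => ?_))
    have e : (u x - c * (t : ℂ) ^ 2 / 2 * h x) - (1 - c * (t : ℂ) ^ 2 / 2) * u x =
        c * (t : ℂ) ^ 2 / 2 * (t * Complex.I * A x + (t : ℂ) ^ 2 * b x) := by
      simp only [hu]; ring
    have hn : ‖(t * Complex.I * A x + (t : ℂ) ^ 2 * b x : ℂ)‖ ≤ |t| * (‖A x‖ + ‖b x‖) := by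
      calc _ ≤ |t| * ‖A x‖ + |t| ^ 2 * ‖b x‖ := by
            refine (norm_add_le _ _).trans (le_of_eq ?_); simp
        _ ≤ |t| * ‖A x‖ + |t| * ‖b x‖ := by
            gcongr
            exact pow_le_of_le_one (abs_nonneg t) ht1 two_ne_zero
        _ = _ := by ring
    change ‖(u x - c * (t : ℂ) ^ 2 / 2 * h x) - (1 - c * (t : ℂ) ^ 2 / 2) * u x‖ ≤
      |t| ^ 3 * (‖c‖ / 2 * (‖A x‖ + ‖b x‖))
    rw [e, norm_mul]
    calc _ ≤ (‖c‖ * |t| ^ 2 / 2) * (|t| * (‖A x‖ + ‖b x‖)) := by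
          gcongr
          simp
      _ = _ := by ring

/-- Convergence of the characteristic functions of the normalized Birkhoff sums under the invariant
density. -/
theorem tendsto_charIntegral {σsq : ℝ≥0} (H : IsSecondOrder m T φ (σsq : ℝ) h A b)
    (hT : Measure.QuasiMeasurePreserving T m m) (hφ : MemLp φ ∞ m)
    (h1 : ∫ x, h x ∂m = 1) (s : ℝ) :
    Tendsto (fun n : ℕ => charIntegral m T φ (s / √n) n h) atTop
      (𝓝 (Complex.exp (-(σsq * s ^ 2 / 2 : ℝ)))) := by
  obtain ⟨K, -, hK⟩ := exists_bound hφ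
  obtain ⟨M, hM⟩ := H.exists_step_le hT hφ hK
  set t : ℕ → ℝ := fun n => s / √n with ht
  have ht0 : Tendsto t atTop (𝓝 0) :=
    tendsto_const_nhds.div_atTop (Real.tendsto_sqrt_atTop.comp tendsto_natCast_atTop_atTop)
  have hta : Tendsto (fun n => |t n|) atTop (𝓝 0) := by simpa using ht0.abs
  have hsq : ∀ n : ℕ, n ≠ 0 → n * t n ^ 2 = s ^ 2 := by
    intro n hn
    have : (n : ℝ) ≠ 0 := by exact_mod_cast hn
    rw [ht, div_pow, Real.sq_sqrt (Nat.cast_nonneg n)]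
    field_simp
  set u : ℕ → X → ℂ := fun n x => h x + t n * Complex.I * A x + (t n : ℂ) ^ 2 * b x with hu
  have hui : ∀ n, Integrable (u n) m := fun n => H.integrable_approx _
  have c1 : Tendsto (fun n => charIntegral m T φ (t n) n h - charIntegral m T φ (t n) n (u n))
      atTop (𝓝 0) := by
    have hz : Tendsto (fun n => |t n| * ∫ x, ‖A x‖ ∂m + |t n| ^ 2 * ∫ x, ‖b x‖ ∂m) atTop
        (𝓝 0) := by
      simpa using (hta.mul_const (∫ x, ‖A x‖ ∂m)).add ((hta.pow 2).mul_const (∫ x, ‖b x‖ ∂m))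
    refine squeeze_zero_norm (fun n => ?_) hz
    rw [← charIntegral_sub hT hφ _ _ H.zeroth.left (hui n), ← integral_const_mul,
      ← integral_const_mul, ← integral_add (H.first.right.norm.const_mul _)
        (H.second.right.norm.const_mul _)]
    refine (norm_charIntegral_le _ _ _).trans (integral_mono_ae
      (H.zeroth.left.sub (hui n)).norm ((H.first.right.norm.const_mul _).add
        (H.second.right.norm.const_mul _)) (ae_of_all _ fun x => ?_))
    have e : h x - u n x = -(t n * Complex.I * A x + (t n : ℂ) ^ 2 * b x) := by
      simp only [hu]; ring
    change ‖h x - u n x‖ ≤ |t n| * ‖A x‖ + |t n| ^ 2 * ‖b x‖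
    rw [e, norm_neg]
    refine (norm_add_le _ _).trans (le_of_eq ?_)
    simp
  set q : ℕ → ℂ := fun n => 1 - (σsq : ℝ) * (t n : ℂ) ^ 2 / 2 with hq
  have hqr : ∀ n, q n = ((1 - σsq * t n ^ 2 / 2 : ℝ) : ℂ) := fun n => by
    simp only [hq]; push_cast; ring
  -- Since `n t² = s²`, the accumulated error `n |t|³ M` equals `|t| s² M`.
  have c2 : Tendsto (fun n => charIntegral m T φ (t n) n (u n) -
      q n ^ n * charIntegral m T φ (t n) 0 (u n)) atTop (𝓝 0) := by
    have hz : Tendsto (fun n => |t n| * (s ^ 2 * M)) atTop (𝓝 0) := by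
      simpa using hta.mul_const (s ^ 2 * M)
    have e1 : ∀ᶠ n in atTop, |t n| < 1 := hta.eventually_lt_const one_pos
    have e2 : ∀ᶠ n in atTop, |t n| * K < 1 :=
      (show Tendsto (fun n => |t n| * K) atTop (𝓝 0) by
        simpa using hta.mul_const K).eventually_lt_const one_pos
    -- Together with `σsq ≥ 0` this puts `q n` in `(0, 1]`.
    have e3 : ∀ᶠ n in atTop, (σsq : ℝ) * t n ^ 2 / 2 < 1 :=
      (show Tendsto (fun n => (σsq : ℝ) * t n ^ 2 / 2) atTop (𝓝 0) by
        simpa using ((ht0.pow 2).const_mul (σsq : ℝ)).div_const 2).eventually_lt_const one_pos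
    refine squeeze_zero_norm' ?_ hz
    filter_upwards [e1, e2, e3, eventually_ne_atTop 0] with n h1 h2 h3 hn
    have hqn : ‖q n‖ ≤ 1 := by
      have : 0 ≤ (σsq : ℝ) * t n ^ 2 / 2 := by positivity
      rw [hqr, Complex.norm_real, Real.norm_eq_abs, abs_le]
      constructor <;> linarith
    refine (norm_sub_pow_mul_le (z := fun k => charIntegral m T φ (t n) k (u n)) hqn
      (fun k => hM (t n) h1.le h2.le k) n).trans (le_of_eq ?_)
    rw [← hsq n hn, ← sq_abs (t n)]
    ring
  have c3 : Tendsto (fun n => q n ^ n) atTop (𝓝 (Complex.exp (-(σsq * s ^ 2 / 2 : ℝ)))) := by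
    have := (Complex.continuous_ofReal.tendsto _).comp
      (Real.tendsto_one_add_div_pow_exp (-(σsq * s ^ 2 / 2)))
    rw [Complex.ofReal_exp, Complex.ofReal_neg] at this
    refine this.congr' ?_
    filter_upwards [eventually_ne_atTop 0] with n hn
    have hn' : (n : ℝ) ≠ 0 := by exact_mod_cast hn
    simp only [Function.comp_apply]
    rw [hqr, ← Complex.ofReal_pow, ← hsq n hn]
    congr 2
    field_simp
    ring
  have c4 : Tendsto (fun n => charIntegral m T φ (t n) 0 (u n)) atTop (𝓝 1) := by
    have e : ∀ n, charIntegral m T φ (t n) 0 (u n) =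
        1 + t n * Complex.I * ∫ x, A x ∂m + (t n : ℂ) ^ 2 * ∫ x, b x ∂m := by
      intro n
      rw [charIntegral_zero, ← integral_const_mul, ← integral_const_mul, ← h1,
        ← integral_add H.zeroth.left (H.first.right.const_mul _)]
      exact integral_add (H.zeroth.left.add (H.first.right.const_mul _))
        (H.second.right.const_mul _)
    simp_rw [e]
    have htc : Tendsto (fun n => (t n : ℂ)) atTop (𝓝 0) := by
      simpa [Function.comp_def] using (Complex.continuous_ofReal.tendsto 0).comp ht0
    simpa using ((tendsto_const_nhds (x := (1 : ℂ))).add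
      ((htc.mul_const Complex.I).mul_const (∫ x, A x ∂m))).add
      ((htc.pow 2).mul_const (∫ x, b x ∂m))
  have c5 := (c1.add c2).add (c3.mul c4)
  simp only [zero_add, mul_one] at c5
  refine c5.congr fun n => ?_
  ring

end IsSecondOrder

end CharIntegral

/-! ### Densities and positivity. -/

section Density

variable {X : Type*} [MeasurableSpace X] {m : Measure X} {T : X → X}

/-- The density of `ν` with respect to `m`, as a complex function. -/
noncomputable def density (ν m : Measure X) : X → ℂ := fun x => ((ν.rnDeriv m x).toReal : ℂ)

theorem integral_density_mul {ν : Measure X} [IsFiniteMeasure ν] [SigmaFinite m] (hν : ν ≪ m)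
    (F : X → ℂ) : ∫ x, F x * density ν m x ∂m = ∫ x, F x ∂ν := by
  rw [← integral_rnDeriv_smul hν]
  refine integral_congr_ae (ae_of_all _ fun x => ?_)
  simp only [density, Complex.real_smul]
  ring

theorem integral_density {ν : Measure X} [IsProbabilityMeasure ν] [SigmaFinite m] (hν : ν ≪ m) :
    ∫ x, density ν m x ∂m = 1 := by
  simpa using integral_density_mul hν fun _ => 1

theorem setIntegral_density {ν : Measure X} [IsFiniteMeasure ν] [SigmaFinite m] (hν : ν ≪ m)
    (s : Set X) : ∫ x in s, density ν m x ∂m = (ν.real s : ℂ) := by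
  rw [← Measure.setIntegral_toReal_rnDeriv hν s]
  exact integral_complex_ofReal

theorem integrable_density (ν m : Measure X) [IsFiniteMeasure ν] :
    Integrable (density ν m) m :=
  Integrable.ofReal Measure.integrable_toReal_rnDeriv

theorem isTransfer_density [IsFiniteMeasure m] (hT : Measure.QuasiMeasurePreserving T m m)
    {μ : Measure X} [IsFiniteMeasure μ] (hμ : μ ≪ m) (hinv : MeasurePreserving T μ μ) :
    IsTransfer m T (density μ m) (density μ m) := by
  refine isTransfer_of_setIntegral hT (integrable_density μ m) (integrable_density μ m)
    fun s hs => ?_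
  rw [setIntegral_density hμ, setIntegral_density hμ,
    hinv.measureReal_preimage hs.nullMeasurableSet]

theorem eq_zero_of_forall_natCast_mul_le {r C : ℝ} (h : ∀ n : ℕ, n * r ≤ C) : r ≤ 0 := by
  by_contra! hr
  obtain ⟨n, hn⟩ := exists_nat_gt (C / r)
  rw [div_lt_iff₀ hr] at hn
  exact (h n).not_gt hn

/-- A fixed point of the transfer operator cohomologous to `1` is a nonnegative function. -/
theorem setIntegral_nonneg_of_coboundary [IsFiniteMeasure m] (hT : Measurable T) {h w : X → ℂ}
    (hh : IsTransfer m T h h) (hw : IsTransfer m T w (fun x => w x - (1 - h x))) {s : Set X}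
    (hs : MeasurableSet s) :
    0 ≤ (∫ x in s, h x ∂m).re ∧ (∫ x in s, h x ∂m).im = 0 := by
  set z := ∫ x in s, h x ∂m with hz
  set S : ℕ → Set X := fun k => T^[k] ⁻¹' s with hS
  have hSm : ∀ k, MeasurableSet (S k) := fun k => hT.iterate k hs
  have hsucc : ∀ k, T ⁻¹' S k = S (k + 1) := fun k => rfl
  have hSz : ∀ k, ∫ x in S k, h x ∂m = z := by
    intro k
    induction k with
    | zero => rfl
    | succ k ih => rw [← hsucc, ← hh.setIntegral_eq hT (hSm k), ih]
  have hI : Integrable (fun x => 1 - h x) m := (integrable_const _).sub hh.left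
  have hstep : ∀ k, ∫ x in S (k + 1), w x ∂m = (∫ x in S k, w x ∂m) - (m.real (S k) - z) := by
    intro k
    rw [← hsucc, ← hw.setIntegral_eq hT (hSm k), ← hSz k,
      integral_sub hw.left.integrableOn hI.integrableOn,
      integral_sub (integrable_const _) hh.left.integrableOn]
    simp
  -- The coboundary telescopes: `n z` is a nonnegative real up to an error bounded in `n`, so
  -- dividing by `n` leaves `z` real and nonnegative.
  have hsum : ∀ n : ℕ, n * z = (∑ k ∈ Finset.range n, m.real (S k) : ℝ) +
      ((∫ x in S n, w x ∂m) - ∫ x in S 0, w x ∂m) := by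
    intro n
    induction n with
    | zero => simp
    | succ n ih =>
      rw [Finset.sum_range_succ, hstep]
      push_cast at ih ⊢
      linear_combination ih
  have hbound : ∀ k, ‖∫ x in S k, w x ∂m‖ ≤ ∫ x, ‖w x‖ ∂m := fun k =>
    (norm_integral_le_integral_norm _).trans
      (setIntegral_le_integral hw.left.norm (ae_of_all _ fun x => norm_nonneg _))
  have hd : ∀ n, ‖(∫ x in S n, w x ∂m) - ∫ x in S 0, w x ∂m‖ ≤ 2 * ∫ x, ‖w x‖ ∂m := fun n => by
    linarith [norm_sub_le (∫ x in S n, w x ∂m) (∫ x in S 0, w x ∂m), hbound n, hbound 0]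
  have him : ∀ n : ℕ, |n * z.im| ≤ 2 * ∫ x, ‖w x‖ ∂m := by
    intro n
    refine le_trans (le_of_eq ?_) ((Complex.abs_im_le_norm _).trans (hd n))
    have := congrArg Complex.im (hsum n)
    rw [Complex.add_im, Complex.ofReal_im, zero_add] at this
    rw [← this]
    simp
  have hre : ∀ n : ℕ, n * (-z.re) ≤ 2 * ∫ x, ‖w x‖ ∂m := by
    intro n
    have h1 := congrArg Complex.re (hsum n)
    rw [Complex.add_re, Complex.ofReal_re] at h1
    have h2 := (abs_le.1 ((Complex.abs_re_le_norm _).trans (hd n))).1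
    have h3 : 0 ≤ ∑ k ∈ Finset.range n, m.real (S k) :=
      Finset.sum_nonneg fun _ _ => measureReal_nonneg
    simp at h1
    simp at h2
    linarith
  refine ⟨by linarith [eq_zero_of_forall_natCast_mul_le hre], le_antisymm
    (eq_zero_of_forall_natCast_mul_le fun n => (le_abs_self _).trans (him n)) ?_⟩
  have : -z.im ≤ 0 := eq_zero_of_forall_natCast_mul_le fun n => by
    rw [mul_neg]; exact (neg_le_abs _).trans (him n)
  linarith

end Density

/-! ### Existence and uniqueness of the invariant measure. -/

section Acip

variable {X : Type*} [MeasurableSpace X] {m : Measure X} [IsProbabilityMeasure m]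
  {B : Type*} [NormedAddCommGroup B] [NormedSpace ℂ B] {ι : B →L[ℂ] Lp ℂ 1 m}
  {T : X → X} {P : B →L[ℂ] B}

theorem IsAcipIn.exists_fixed (hB : IsAdmissible ι T P)
    (hT : Measure.QuasiMeasurePreserving T m m) {μ : Measure X} (hμ : IsAcipIn ι T μ) :
    ∃ b : B, ι b =ᵐ[m] density μ m ∧ P b = b ∧ ∫ x, ι b x ∂m = 1 := by
  have := hμ.prob
  obtain ⟨b, hb⟩ := hμ.density
  refine ⟨b, hb, hB.injective (Lp.ext ?_), (integral_congr_ae hb).trans (integral_density hμ.ac)⟩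
  have h1 := hB.isTransfer hT b
  have h2 := (isTransfer_density hT hμ.ac hμ.invariant).congr hb.symm hb.symm
  refine h1.right.ae_eq_of_forall_setIntegral_eq _ _ h2.right fun s hs _ => ?_
  rw [h1.setIntegral_eq hT.measurable hs, h2.setIntegral_eq hT.measurable hs]

theorem IsAcipIn.unique (hB : IsAdmissible ι T P) (hT : Measure.QuasiMeasurePreserving T m m)
    {μ ν : Measure X} (hμ : IsAcipIn ι T μ) (hν : IsAcipIn ι T ν) : μ = ν := by
  have := hμ.prob
  have := hν.prob
  obtain ⟨b, hb, hPb, hb1⟩ := hμ.exists_fixed hB hT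
  obtain ⟨c, hc, hPc, hc1⟩ := hν.exists_fixed hB hT
  rw [hB.eq_of_fixed hPb hPc hb1 hc1] at hb
  rw [← Measure.withDensity_rnDeriv_eq μ m hμ.ac, ← Measure.withDensity_rnDeriv_eq ν m hν.ac]
  refine withDensity_congr_ae ?_
  filter_upwards [hb, hc, μ.rnDeriv_lt_top m, ν.rnDeriv_lt_top m] with x h1 h2 h3 h4
  have h := h1.symm.trans h2
  simp only [density, Complex.ofReal_inj] at h
  exact (ENNReal.toReal_eq_toReal_iff' h3.ne h4.ne).1 h

theorem IsAdmissible.exists_isAcipIn [CompleteSpace B] (hB : IsAdmissible ι T P)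
    (hT : Measure.QuasiMeasurePreserving T m m) : ∃ μ : Measure X, IsAcipIn ι T μ := by
  obtain ⟨b, hPb, hb1, -⟩ := hB.exists_fixed hT
  have hh : IsTransfer m T (ι b) (ι b) := by simpa only [hPb] using hB.isTransfer hT b
  have hbs : InSpace ι (ι b) := ⟨b, ae_eq_refl _⟩
  -- The density `1` of `m` and the fixed point have the same integral, so they are cohomologous.
  obtain ⟨w, -, -, hw⟩ := hB.exists_isTransfer_sub hT ((hB.const_mem 1).sub hbs) (by
    rw [integral_sub (integrable_const _) hh.left, hb1]; simp)
  have hset : ∀ s, MeasurableSet s → 0 ≤ (∫ x in s, ι b x ∂m).re ∧ (∫ x in s, ι b x ∂m).im = 0 :=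
    fun s hs => setIntegral_nonneg_of_coboundary hT.measurable hh hw hs
  set r : X → ℝ := fun x => (ι b x).re with hr
  have hri : Integrable r m := hh.left.re
  have hrset : ∀ s, ∫ x in s, r x ∂m = (∫ x in s, ι b x ∂m).re := fun s =>
    integral_re hh.left.integrableOn
  have hr0 : 0 ≤ᵐ[m] r := ae_nonneg_of_forall_setIntegral_nonneg hri fun s hs _ => by
    rw [hrset]; exact (hset s hs).1
  have him : (fun x => (ι b x).im) =ᵐ[m] 0 := by
    refine Integrable.ae_eq_zero_of_forall_setIntegral_eq_zero hh.left.im fun s hs _ => ?_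
    exact (integral_im hh.left.integrableOn).trans (hset s hs).2
  set μ : Measure X := m.withDensity fun x => ENNReal.ofReal (r x) with hμdef
  have hμs : ∀ s, MeasurableSet s → μ s = ENNReal.ofReal (∫ x in s, ι b x ∂m).re := fun s hs => by
    rw [hμdef, withDensity_apply _ hs, ← hrset,
      ofReal_integral_eq_lintegral_ofReal hri.integrableOn (ae_restrict_of_ae hr0)]
  refine ⟨μ, ⟨⟨⟨?_⟩, withDensity_absolutelyContinuous _ _, b, ?_⟩, ⟨hT.measurable, ?_⟩⟩⟩
  · rw [hμs _ MeasurableSet.univ, Measure.restrict_univ, hb1]; simp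
  · filter_upwards [Measure.rnDeriv_withDensity₀ m hri.1.aemeasurable.ennreal_ofReal, hr0, him]
      with x h1 h2 h3
    rw [h1, ENNReal.toReal_ofReal h2]
    exact Complex.ext rfl h3
  · ext s hs
    rw [Measure.map_apply hT.measurable hs, hμs _ (hT.measurable hs), hμs s hs,
      hh.setIntegral_eq hT.measurable hs]

end Acip

/-! ### Asymptotic variance. -/

section Variance

variable {X : Type*} [MeasurableSpace X] {m : Measure X} {T : X → X} {φ : X → ℝ}

/-- The second moments of the Birkhoff sums grow linearly, up to a bounded error. -/
theorem integral_birkhoffSum_sq_mul (hT : Measure.QuasiMeasurePreserving T m m)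
    (hφ : MemLp φ ∞ m) {h A v : X → ℂ} (hh : IsTransfer m T h h)
    (hA : IsTransfer m T (fun x => φ x * h x + A x) A)
    (hv : IsTransfer m T v (fun x => v x - A x)) (n : ℕ) :
    ∫ x, ((birkhoffSum T φ n x : ℝ) : ℂ) ^ 2 * h x ∂m =
      n * ((∫ x, (φ x : ℂ) ^ 2 * h x ∂m) + 2 * ∫ x, φ x * A x ∂m) -
        2 * ((∫ x, φ x * v x ∂m) - ∫ x, φ (T^[n] x) * v x ∂m) := by
  induction n with
  | zero => simp
  | succ n ih =>
    have hφc : MemLp (fun x => (φ x : ℂ)) ∞ m := hφ.ofReal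
    have hSc : MemLp (fun x => ((birkhoffSum T φ n x : ℝ) : ℂ)) ∞ m :=
      (memLp_top_birkhoffSum hT hφ n).ofReal
    have hSTc := memLp_top_comp hT hSc
    have hφn : MemLp (fun x => (φ (T^[n] x) : ℂ)) ∞ m := (memLp_top_iterate hT hφ n).ofReal
    have hS2 : MemLp (fun x => ((birkhoffSum T φ n x : ℝ) : ℂ) ^ 2) ∞ m := by
      simp_rw [pow_two]; exact hSc.mul (r := ∞) hSc
    have hφ2 : MemLp (fun x => (φ x : ℂ) ^ 2) ∞ m := by
      simp_rw [pow_two]; exact hφc.mul (r := ∞) hφc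
    have iφh := integrable_mul hφc hh.left
    -- Test `P (φ h + A) = A` against `S_n` and use `S_n ∘ T - S_n = φ ∘ T^[n] - φ`; the integrals
    -- of `S_n A` cancel.
    have cross : ∫ x, ((birkhoffSum T φ n (T x) : ℝ) : ℂ) * (φ x * h x) ∂m =
        (∫ x, φ x * A x ∂m) - ∫ x, φ (T^[n] x) * A x ∂m := by
      have e1 := hA.dual _ hSc
      simp_rw [mul_add] at e1
      rw [integral_add (integrable_mul hSTc iφh) (integrable_mul hSTc hA.right)] at e1
      have e2 : ∫ x, ((birkhoffSum T φ n (T x) : ℝ) : ℂ) * A x ∂m =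
          (∫ x, ((birkhoffSum T φ n x : ℝ) : ℂ) * A x ∂m) + (∫ x, φ (T^[n] x) * A x ∂m) -
            ∫ x, φ x * A x ∂m := by
        rw [← integral_add (integrable_mul hSc hA.right) (integrable_mul hφn hA.right)]
        refine Eq.trans (integral_congr_ae (ae_of_all _ fun x => ?_))
          (integral_sub ((integrable_mul hSc hA.right).add (integrable_mul hφn hA.right))
            (integrable_mul hφc hA.right))
        simp only [birkhoffSum_comp]
        push_cast
        ring
      linear_combination -e1 - e2
    -- Writing `A = v - P v` makes the correlations telescope in `n`, so no decay of correlations is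
    -- needed.
    have hvn : ∫ x, φ (T^[n] x) * A x ∂m =
        (∫ x, φ (T^[n] x) * v x ∂m) - ∫ x, φ (T^[n + 1] x) * v x ∂m := by
      have e1 := hv.dual _ hφn
      simp_rw [mul_sub] at e1
      rw [integral_sub (integrable_mul hφn hv.left) (integrable_mul hφn hA.right)] at e1
      simp_rw [Function.iterate_succ_apply]
      linear_combination -e1
    have hsq : ∫ x, ((birkhoffSum T φ n (T x) : ℝ) : ℂ) ^ 2 * h x ∂m =
        ∫ x, ((birkhoffSum T φ n x : ℝ) : ℂ) ^ 2 * h x ∂m := (hh.dual _ hS2).symm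
    have expand : ∫ x, ((birkhoffSum T φ (n + 1) x : ℝ) : ℂ) ^ 2 * h x ∂m =
        (∫ x, (φ x : ℂ) ^ 2 * h x ∂m) +
          2 * (∫ x, ((birkhoffSum T φ n (T x) : ℝ) : ℂ) * (φ x * h x) ∂m) +
          ∫ x, ((birkhoffSum T φ n (T x) : ℝ) : ℂ) ^ 2 * h x ∂m := by
      rw [← integral_const_mul, ← integral_add (integrable_mul hφ2 hh.left)
        ((integrable_mul hSTc iφh).const_mul _)]
      refine Eq.trans (integral_congr_ae (ae_of_all _ fun x => ?_)) (integral_add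
        ((integrable_mul hφ2 hh.left).add ((integrable_mul hSTc iφh).const_mul _))
        (integrable_mul (memLp_top_comp hT hS2) hh.left))
      simp only [birkhoffSum_succ']
      push_cast
      ring
    rw [expand, hsq, ih, cross, hvn]
    push_cast
    ring

theorem tendsto_integral_birkhoffSum_sq_mul (hT : Measure.QuasiMeasurePreserving T m m)
    (hφ : MemLp φ ∞ m) {h A v : X → ℂ} (hh : IsTransfer m T h h)
    (hA : IsTransfer m T (fun x => φ x * h x + A x) A)
    (hv : IsTransfer m T v (fun x => v x - A x)) :
    Tendsto (fun n : ℕ => (∫ x, ((birkhoffSum T φ n x : ℝ) : ℂ) ^ 2 * h x ∂m) / n) atTop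
      (𝓝 ((∫ x, (φ x : ℂ) ^ 2 * h x ∂m) + 2 * ∫ x, φ x * A x ∂m)) := by
  set c := (∫ x, (φ x : ℂ) ^ 2 * h x ∂m) + 2 * ∫ x, φ x * A x ∂m with hc
  obtain ⟨K, hK0, hK⟩ := exists_bound hφ
  have hb : ∀ n, ‖∫ x, φ (T^[n] x) * v x ∂m‖ ≤ K * ∫ x, ‖v x‖ ∂m := fun n => by
    rw [← integral_const_mul]
    refine norm_integral_le_of_norm_le (hv.left.norm.const_mul _) ?_
    filter_upwards [(hT.iterate n).ae hK] with x hx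
    rw [norm_mul, Complex.norm_real]
    gcongr
  have hd : Tendsto (fun n : ℕ => (4 * (K * ∫ x, ‖v x‖ ∂m)) / (n : ℝ)) atTop (𝓝 0) :=
    tendsto_const_nhds.div_atTop tendsto_natCast_atTop_atTop
  rw [tendsto_iff_norm_sub_tendsto_zero]
  refine squeeze_zero' (Eventually.of_forall fun _ => norm_nonneg _) ?_ hd
  filter_upwards [eventually_ne_atTop 0] with n hn
  have hn' : (n : ℂ) ≠ 0 := by exact_mod_cast hn
  have e : (∫ x, ((birkhoffSum T φ n x : ℝ) : ℂ) ^ 2 * h x ∂m) / n - c =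
      -(2 * ((∫ x, φ (T^[0] x) * v x ∂m) - ∫ x, φ (T^[n] x) * v x ∂m)) / n := by
    rw [integral_birkhoffSum_sq_mul hT hφ hh hA hv n, ← hc]
    simp only [Function.iterate_zero, id_eq]
    field_simp
    ring
  rw [e, norm_div, norm_neg, norm_mul, Complex.norm_natCast, Complex.norm_ofNat]
  refine div_le_div_of_nonneg_right ?_ (Nat.cast_nonneg n)
  linarith [norm_sub_le (∫ x, φ (T^[0] x) * v x ∂m) (∫ x, φ (T^[n] x) * v x ∂m), hb 0, hb n]

end Variance

/-! ### Passage to the Gaussian limit. -/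

section Limit

variable {X : Type*} [MeasurableSpace X] {m : Measure X}

/-- **Lévy's theorem** for integrals of bounded continuous functions of random variables. -/
theorem tendsto_integral_gaussianReal {ν : Measure X} [IsProbabilityMeasure ν] {F : ℕ → X → ℝ}
    (hF : ∀ n, AEMeasurable (F n) ν) {σsq : ℝ≥0}
    (h : ∀ s : ℝ, Tendsto (fun n => ∫ x, Complex.exp (s * F n x * Complex.I) ∂ν) atTop
      (𝓝 (Complex.exp (-(σsq * s ^ 2 / 2 : ℝ))))) (g : ℝ →ᵇ ℝ) :
    Tendsto (fun n => ∫ x, g (F n x) ∂ν) atTop (𝓝 (∫ y, g y ∂(gaussianReal 0 σsq))) := by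
  have hp : ∀ n, IsProbabilityMeasure (ν.map (F n)) := fun n =>
    Measure.isProbabilityMeasure_map (hF n)
  let κ : ℕ → ProbabilityMeasure ℝ := fun n => ⟨ν.map (F n), hp n⟩
  let γ : ProbabilityMeasure ℝ := ⟨gaussianReal 0 σsq, inferInstance⟩
  have key : Tendsto κ atTop (𝓝 γ) := by
    refine ProbabilityMeasure.tendsto_iff_tendsto_charFun.2 fun s => ?_
    simp only [κ, γ, ProbabilityMeasure.coe_mk]
    rw [charFun_gaussianReal]
    have e : Complex.exp (s * (0 : ℝ) * Complex.I - (σsq : ℝ) * (s : ℂ) ^ 2 / 2) =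
        Complex.exp (-(σsq * s ^ 2 / 2 : ℝ)) := by
      congr 1; push_cast; ring
    rw [e]
    refine (h s).congr fun n => ?_
    rw [charFun_apply_real, integral_map (hF n)]
    exact (Continuous.aestronglyMeasurable (by fun_prop))
  refine (ProbabilityMeasure.tendsto_iff_forall_integral_tendsto.1 key g).congr fun n => ?_
  exact integral_map (hF n) g.continuous.aestronglyMeasurable

theorem integral_exp_div_sqrt [SigmaFinite m] {T : X → X} {φ : X → ℝ} {ν : Measure X}
    [IsFiniteMeasure ν] (hν : ν ≪ m) (s : ℝ) (n : ℕ) :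
    ∫ x, Complex.exp (s * (birkhoffSum T φ n x / √n : ℝ) * Complex.I) ∂ν =
      charIntegral m T φ (s / √n) n (density ν m) := by
  rw [← integral_density_mul hν, charIntegral]
  refine integral_congr_ae (ae_of_all _ fun x => ?_)
  change _ * _ = _ * _
  congr 3
  push_cast
  ring

variable [IsProbabilityMeasure m]
  {B : Type*} [NormedAddCommGroup B] [NormedSpace ℂ B] [CompleteSpace B] {ι : B →L[ℂ] Lp ℂ 1 m}
  {T : X → X} {P : B →L[ℂ] B} {φ : X → ℝ}

/-- The density of an invariant measure extends to a second order approximate eigenfunction, whose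
coefficient `c` is the asymptotic variance. -/
theorem IsAdmissible.exists_isSecondOrder (hB : IsAdmissible ι T P)
    (hT : Measure.QuasiMeasurePreserving T m m) (hφ : MemLp φ ∞ m)
    (hφB : InSpace ι fun x => (φ x : ℂ)) {h : X → ℂ} (hh : IsTransfer m T h h)
    (hhB : InSpace ι h) (hh1 : ∫ x, h x ∂m = 1) (h0 : ∫ x, φ x * h x ∂m = 0) :
    ∃ (c : ℂ) (A b : X → ℂ), IsSecondOrder m T φ c h A b ∧
      Tendsto (fun n : ℕ => (∫ x, ((birkhoffSum T φ n x : ℝ) : ℂ) ^ 2 * h x ∂m) / n) atTop (𝓝 c) := by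
  have hφh := hB.mul hφB hhB
  obtain ⟨a, haB, ha0, ha⟩ := hB.exists_isTransfer_sub hT hφh h0
  set A : X → ℂ := fun x => a x - φ x * h x with hA
  have hAB : InSpace ι A := haB.sub hφh
  have hAt : IsTransfer m T (fun x => φ x * h x + A x) A :=
    ha.congr (ae_of_all _ fun x => by simp only [hA]; ring) (ae_eq_refl _)
  have hA0 : ∫ x, A x ∂m = 0 := ha.integral_eq.trans ha0
  obtain ⟨v, -, -, hv⟩ := hB.exists_isTransfer_sub hT hAB hA0
  -- The only value for which `g` below has zero integral. As `A` is formally `∑ k ≥ 1, P^k (φ h)`,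
  -- this is the Green–Kubo formula.
  set c := (∫ x, (φ x : ℂ) ^ 2 * h x ∂m) + 2 * ∫ x, φ x * A x ∂m with hc
  have hφA := hB.mul hφB hAB
  have hφφh : InSpace ι fun x => (φ x : ℂ) ^ 2 / 2 * h x :=
    ((hB.mul hφB hφh).const_mul (1 / 2)).congr (ae_of_all _ fun x => by ring)
  set g : X → ℂ := fun x => c / 2 * h x - φ x * A x - (φ x : ℂ) ^ 2 / 2 * h x with hg
  have hgB : InSpace ι g := ((hhB.const_mul (c / 2)).sub hφA).sub hφφh
  have hg0 : ∫ x, g x ∂m = 0 := by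
    have e : ∫ x, (φ x : ℂ) ^ 2 / 2 * h x ∂m = 1 / 2 * ∫ x, (φ x : ℂ) ^ 2 * h x ∂m := by
      rw [← integral_const_mul]
      exact integral_congr_ae (ae_of_all _ fun x => by ring)
    refine (integral_sub ((hh.left.const_mul _).sub hφA.integrable) hφφh.integrable).trans ?_
    rw [integral_sub' (hh.left.const_mul _) hφA.integrable, integral_const_mul, hh1, e, hc]
    ring
  obtain ⟨b, -, -, hb⟩ := hB.exists_isTransfer_sub hT hgB hg0
  refine ⟨c, A, fun x => b x - g x, ⟨hh, hAt, hb.congr (ae_of_all _ fun x => ?_) (ae_eq_refl _)⟩,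
    tendsto_integral_birkhoffSum_sq_mul hT hφ hh hAt hv⟩
  simp only [hg]
  ring

theorem tendsto_charIntegral_of_inSpace (hB : IsAdmissible ι T P)
    (hT : Measure.QuasiMeasurePreserving T m m) (hφ : MemLp φ ∞ m) {h ρ : X → ℂ}
    (hhB : InSpace ι h) (hρB : InSpace ι ρ) (heq : ∫ x, ρ x ∂m = ∫ x, h x ∂m) {s : ℝ} {z : ℂ}
    (hz : Tendsto (fun n : ℕ => charIntegral m T φ (s / √n) n h) atTop (𝓝 z)) :
    Tendsto (fun n : ℕ => charIntegral m T φ (s / √n) n ρ) atTop (𝓝 z) := by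
  obtain ⟨K, -, hK⟩ := exists_bound hφ
  obtain ⟨w, -, -, hw⟩ := hB.exists_isTransfer_sub hT (hρB.sub hhB) (by
    rw [integral_sub hρB.integrable hhB.integrable, heq, sub_self])
  have ht : Tendsto (fun n : ℕ => |s / √n| * (2 * K * ∫ x, ‖w x‖ ∂m)) atTop (𝓝 0) := by
    have : Tendsto (fun n : ℕ => s / √n) atTop (𝓝 0) :=
      tendsto_const_nhds.div_atTop (Real.tendsto_sqrt_atTop.comp tendsto_natCast_atTop_atTop)
    simpa using this.abs.mul_const (2 * K * ∫ x, ‖w x‖ ∂m)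
  have hd : Tendsto (fun n : ℕ => charIntegral m T φ (s / √n) n ρ -
      charIntegral m T φ (s / √n) n h) atTop (𝓝 0) := by
    refine squeeze_zero_norm (fun n => ?_) ht
    have := norm_charIntegral_coboundary_le hT hφ hK hw (s / √n) n
    simp only [sub_sub_cancel] at this
    rwa [charIntegral_sub hT hφ _ _ hρB.integrable hhB.integrable] at this
  simpa using hd.add hz

end Limit

end TransferCLT

/-! ### The central limit theorem. -/

open TransferCLT in
theorem theorem2 {X : Type*} [MeasurableSpace X] (m : Measure X) [IsProbabilityMeasure m]
    (T : X → X) (hT : Measure.QuasiMeasurePreserving T m m)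
    {B : Type*} [NormedAddCommGroup B] [NormedSpace ℂ B] [CompleteSpace B]
    (ι : B →L[ℂ] Lp ℂ 1 m) (P : B →L[ℂ] B) (hB : TransferCLT.IsAdmissible ι T P) :
    (∃! μ : Measure X, TransferCLT.IsAcipIn ι T μ) ∧
    ∀ μ : Measure X, TransferCLT.IsAcipIn ι T μ →
    ∀ φ : X → ℝ, (∃ K : ℝ, ∀ᵐ x ∂m, |φ x| ≤ K) →
      TransferCLT.InSpace ι (fun x => (φ x : ℂ)) → ∫ x, φ x ∂μ = 0 →
    ∃ σsq : ℝ≥0,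
      Tendsto (fun n : ℕ => ∫ x, (birkhoffSum T φ n x / √(n : ℝ)) ^ 2 ∂μ) atTop
        (𝓝 (σsq : ℝ)) ∧
      ∀ ν : Measure X, TransferCLT.IsProbWithDensityIn ι ν →
      ∀ g : ℝ →ᵇ ℝ,
        Tendsto (fun n : ℕ => ∫ x, g (birkhoffSum T φ n x / √(n : ℝ)) ∂ν) atTop
          (𝓝 (∫ y, g y ∂(gaussianReal 0 σsq))) := by
  refine ⟨?_, fun μ hμ φ ⟨K, hK⟩ hφB hφ0 => ?_⟩
  · obtain ⟨μ, hμ⟩ := hB.exists_isAcipIn hT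
    exact ⟨μ, hμ, fun ν hν => hν.unique hB hT hμ⟩
  have := hμ.prob
  have hφ : MemLp φ ∞ m :=
    memLp_top_of_bound (Complex.continuous_re.comp_aestronglyMeasurable hφB.integrable.1) K hK
  have hh := isTransfer_density hT hμ.ac hμ.invariant
  have h0 : ∫ x, φ x * density μ m x ∂m = 0 := by
    rw [integral_density_mul hμ.ac, integral_complex_ofReal, hφ0, Complex.ofReal_zero]
  obtain ⟨c, A, b, H, hc⟩ := hB.exists_isSecondOrder hT hφ hφB hh hμ.density
    (integral_density hμ.ac) h0
  -- At `n = 0` both sides vanish, division by zero being zero.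
  have hvar : ∀ n : ℕ, (∫ x, ((birkhoffSum T φ n x : ℝ) : ℂ) ^ 2 * density μ m x ∂m) / n =
      ((∫ x, (birkhoffSum T φ n x / √(n : ℝ)) ^ 2 ∂μ : ℝ) : ℂ) := by
    intro n
    rw [integral_density_mul hμ.ac, ← integral_complex_ofReal, ← integral_div]
    refine integral_congr_ae (ae_of_all _ fun x => ?_)
    simp only [div_pow, Real.sq_sqrt (Nat.cast_nonneg n)]
    push_cast
    rfl
  simp_rw [hvar] at hc
  have hre : Tendsto (fun n : ℕ => ∫ x, (birkhoffSum T φ n x / √(n : ℝ)) ^ 2 ∂μ) atTop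
      (𝓝 c.re) := (Complex.continuous_re.tendsto c).comp hc
  have him : c.im = 0 := by
    have : Tendsto (fun _ : ℕ => (0 : ℝ)) atTop (𝓝 c.im) :=
      (Complex.continuous_im.tendsto c).comp hc
    exact tendsto_nhds_unique this tendsto_const_nhds
  have hnn : 0 ≤ c.re :=
    ge_of_tendsto' hre fun n => integral_nonneg fun x => sq_nonneg _
  -- The case `c.re = 0` needs no separate treatment: `gaussianReal 0 0` is the Dirac mass at `0`.
  refine ⟨⟨c.re, hnn⟩, hre, fun ν hν g => ?_⟩
  have hcc : c = (((⟨c.re, hnn⟩ : ℝ≥0) : ℝ) : ℂ) := Complex.ext rfl him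
  rw [hcc] at H
  have := hν.prob
  refine tendsto_integral_gaussianReal (fun n => ?_) (fun s => ?_) g
  · exact ((memLp_top_birkhoffSum hT hφ n).1.aemeasurable.mono_ac hν.ac).div_const _
  · simp_rw [integral_exp_div_sqrt hν.ac]
    exact tendsto_charIntegral_of_inSpace hB hT hφ hμ.density hν.density
      ((integral_density hν.ac).trans (integral_density hμ.ac).symm)
      (H.tendsto_charIntegral hT hφ (integral_density hμ.ac) s)
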